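/- Let $n\ge 0$ be an integer. Two players, Constructor and Blocker, alternately claim one unclaimed edge each of the complete graph $K_n$, with Constructor moving first. Constructor may only claim an edge if her graph (the graph on the $n$ vertices formed by the edges she has claimed) then still contains no star $S_4$ with $4$ leaves as a subgraph, i.e. still has maximum degree at most $3$; Blocker may claim any unclaimed edge. The game ends when Constructor cannot claim any more edges or when all edges have been claimed. Its score is the number of triangles $K_3$ in Constructor's graph at the end of the game; Constructor wants to maximize the score and Blocker wants to minimize it. Let $g(n,K_3,S_4)$ denote the score under optimal play by both players. Then $$ g(n,K_3,S_4) = (1+o(1))\,\frac{n}{3} \qquad (n\to\infty). $$ -/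

import Mathlib

namespace ConstructorBlocker

/-- The two players of the game. -/
inductive Player where
  | Con
  | Blo

section Game

variable {V : Type*} [Fintype V] {α β : Type*}

open Classical in
/-- The unclaimed edges of the complete graph on `V`, when `C` is the set of edges claimed by
Constructor and `B` is the set of edges claimed by Blocker. -/
noncomputable def freeEdges (C B : Finset (Sym2 V)) : Finset (Sym2 V) :=
  Finset.univ.filter fun e => e ∈ (⊤ : SimpleGraph V).edgeSet ∧ e ∉ C ∧ e ∉ B

/-- The graph on `V` whose edges are those in `C`. -/
def graph (C : Finset (Sym2 V)) : SimpleGraph V :=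
  SimpleGraph.fromEdgeSet (C : Set (Sym2 V))

open Classical in
/-- The unclaimed edges that Constructor may claim: her graph has to remain `F`-free. -/
noncomputable def legalEdges (F : SimpleGraph β) (C B : Finset (Sym2 V)) : Finset (Sym2 V) :=
  (freeEdges C B).filter fun e => F.Free (graph (insert e C))

theorem legalEdges_subset (F : SimpleGraph β) (C B : Finset (Sym2 V)) :
    legalEdges F C B ⊆ freeEdges C B := by
  classical
  exact Finset.filter_subset _ _

theorem card_freeEdges_insert_left [DecidableEq V] {C B : Finset (Sym2 V)} {e : Sym2 V}
    (he : e ∈ freeEdges C B) : (freeEdges (insert e C) B).card < (freeEdges C B).card := by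
  classical
  apply Finset.card_lt_card
  rw [Finset.ssubset_iff_of_subset]
  · exact ⟨e, he, by simp [freeEdges]⟩
  · intro x hx
    simp only [freeEdges, Finset.mem_filter, Finset.mem_insert, not_or] at hx ⊢
    exact ⟨hx.1, hx.2.1, hx.2.2.1.2, hx.2.2.2⟩

theorem card_freeEdges_insert_right [DecidableEq V] {C B : Finset (Sym2 V)} {e : Sym2 V}
    (he : e ∈ freeEdges C B) : (freeEdges C (insert e B)).card < (freeEdges C B).card := by
  classical
  apply Finset.card_lt_card
  rw [Finset.ssubset_iff_of_subset]
  · exact ⟨e, he, by simp [freeEdges]⟩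
  · intro x hx
    simp only [freeEdges, Finset.mem_filter, Finset.mem_insert, not_or] at hx ⊢
    exact ⟨hx.1, hx.2.1, hx.2.2.1, hx.2.2.2.2⟩

open Classical in
/-- The score under optimal play when the game is continued from the position in which
Constructor has claimed `C`, Blocker has claimed `B`, and it is the turn of the given player.
The game is over as soon as Constructor has no legal edge left (in particular when all edges are
claimed), and the score is then the number of copies of `H` in her graph. Otherwise Constructor
claims a legal edge so as to maximize the score, and Blocker claims an unclaimed edge so as to
minimize it. -/
noncomputable def value (H : SimpleGraph α) (F : SimpleGraph β) :
    Player → Finset (Sym2 V) → Finset (Sym2 V) → ℕ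
  | .Con, C, B =>
    if h : (legalEdges F C B).Nonempty then
      (legalEdges F C B).attach.sup' (Finset.attach_nonempty_iff.mpr h)
        fun e => value H F .Blo (insert e.1 C) B
    else (graph C).copyCount H
  | .Blo, C, B =>
    if h : (legalEdges F C B).Nonempty then
      (freeEdges C B).attach.inf'
        (Finset.attach_nonempty_iff.mpr (h.mono (legalEdges_subset F C B)))
        fun e => value H F .Con C (insert e.1 B)
    else (graph C).copyCount H
termination_by _ C B => (freeEdges C B).card
decreasing_by
  · exact card_freeEdges_insert_left (legalEdges_subset F C B e.2)
  · exact card_freeEdges_insert_right e.2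

end Game

/-- The score `g(n, H, F)` of the Constructor-Blocker game on the complete graph with `n`
vertices under optimal play, with Constructor moving first and no edge claimed yet. -/
noncomputable def g {α β : Type*} (n : ℕ) (H : SimpleGraph α) (F : SimpleGraph β) : ℕ :=
  value (V := Fin n) H F .Con ∅ ∅

/-- The star with `k` leaves. -/
abbrev starS (k : ℕ) : SimpleGraph (Fin (k + 1)) :=
  SimpleGraph.starGraph 0

end ConstructorBlocker

/-! ### Upper bound: Blocker's invariant and its survival -/

namespace ConstructorBlocker

/-! Upper bound: at maximum degree three, two triangles that meet share an edge. If Blocker prevents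
shared edges, all triangles are vertex-disjoint, so there are at most `n / 3`.

For this he maintains `Inv`, in which `d` is the goal. A move creates two triangles on an edge
either by joining two vertices with two common neighbours (`i1`) or by completing a second triangle
on an edge of an old one (`t2`). Blocker has one reply per move, so the other clauses limit
simultaneous threats: `t1` and `j2` provide outside edges at present and imminent triangles, `j3a`
and `j3b` restrict threats around a degree-three vertex, and `k` excludes one bad path component.
`Inv.extend` isolates what a reply must achieve, `Inv.reply` finds it by the degrees of the ends of
Constructor's edge, and `three_mul_value_le` plays the strategy.

Lower bound: Constructor spends three fresh vertices `e`, `f`, `g` and one vertex `d` of a small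
stock per triangle. She builds a claw at `f` with leaves `e`, `g`, `d`; then `ed` and `gd` both
close a triangle and Blocker can stop only one. The unused leaf replaces `d` in the stock. Choosing
fresh vertices of small Blocker degree makes this possible until `O(√n)` fresh vertices remain
(`Stocked.le_value_of_round`, `le_g`). -/

/-- `A` is the adjacency relation of Constructor's graph, which has maximum degree at most three,
and `L` relates the ends of the edges that she may claim, which have degree at most two. -/
structure Position {V : Type*} (A L : V → V → Prop) : Prop where
  symmA : ∀ {x y}, A x y → A y x
  neA : ∀ {x y}, A x y → x ≠ y
  symmL : ∀ {x y}, L x y → L y x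
  neL : ∀ {x y}, L x y → x ≠ y
  notA : ∀ {x y}, L x y → ¬ A x y
  low : ∀ {x y a b c}, L x y → A x a → A x b → A x c → a = b ∨ a = c ∨ b = c
  deg : ∀ {x a b c d}, A x a → A x b → A x c → A x d →
    a = b ∨ a = c ∨ a = d ∨ b = c ∨ b = d ∨ c = d

/-- Blocker's invariant: there are no two triangles with a common edge, and the edges that
Constructor may claim cannot produce threats which Blocker is unable to answer. -/
structure Inv {V : Type*} (A L : V → V → Prop) : Prop where
  d : ∀ {a b c d}, A a b → A a c → A b c → A a d → A b d → c = d
  i1 : ∀ {x y c d}, L x y → A c x → A c y → A d x → A d y → c = d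
  t1 : ∀ {a b c}, A a b → A b c → A a c → ∃ w, w ≠ a ∧ w ≠ b ∧ w ≠ c ∧ (A a w ∨ A b w ∨ A c w)
  t2 : ∀ {a b c w}, A a b → A b c → A a c → A b w → w ≠ a → w ≠ c → ¬ L a w
  j2 : ∀ {c x y}, A c x → A c y → L x y → (∀ z, A c z → z = x ∨ z = y) →
    ∃ w, w ≠ c ∧ (A x w ∨ A y w) ∧ ¬ L w c
  j3a : ∀ {c x y z}, A c x → A c y → A c z → L x y → L x z → ¬ L y z
  j3b : ∀ {c x y z}, A c x → A c y → A c z → y ≠ z → L x y → L x z →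
    (∃ w, w ≠ c ∧ A x w) ∨
      ((∃ w, w ≠ c ∧ A y w ∧ ¬ L w x) ∧ (∃ w, w ≠ c ∧ A z w ∧ ¬ L w x))
  k : ∀ {a b m d e}, A a b → A b m → A m d → A d e → a ≠ e → (∀ z, A a z → z = b) →
    (∀ z, A b z → z = a ∨ z = m) → (∀ z, A m z → z = b ∨ z = d) →
    (∀ z, A d z → z = m ∨ z = e) → (∀ z, A e z → z = d) → L a m → ¬ L m e

variable {V : Type*} {A L A' L' : V → V → Prop} {u v : V}


/-- The conditions at `u` which make the invariant survive the move `uv`. -/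
structure Repaired (A L' : V → V → Prop) (u v : V) : Prop where
  t2a : ∀ {c w}, A u c → A v c → A u w → w ≠ c → ¬ L' v w ∧ ¬ L' c w
  t2b : ∀ {c z}, A u c → A v c → A c z → z ≠ u → z ≠ v → ¬ L' u z
  t2c : ∀ {a b}, A u a → A u b → A a b → ¬ L' v a
  i1 : ∀ {y c}, A u y → A v c → A c y → ¬ L' v y
  j2 : ∀ {x}, A u x → (∀ z, A u z → z = x) → L' v x →
    ∃ w, w ≠ u ∧ (A v w ∨ A x w) ∧ ¬ L' w u
  j3a : ∀ {x y}, A u x → A u y → L' v x → L' v y → ¬ L' x y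
  j3b : ∀ {x y}, A u x → A u y → x ≠ y → L' v x → L' v y → (∃ w, w ≠ u ∧ A v w) ∨
    ((∃ w, w ≠ u ∧ A x w ∧ ¬ L' w v) ∧ (∃ w, w ≠ u ∧ A y w ∧ ¬ L' w v))
  j3c : ∀ {x y}, A u x → A u y → L' x v → L' x y → (∃ w, w ≠ u ∧ A x w) ∨
    ((∃ w, w ≠ u ∧ A v w ∧ ¬ L' w x) ∧ (∃ w, w ≠ u ∧ A y w ∧ ¬ L' w x))
  k : ∀ {m}, (∀ z, ¬ A u z) → A v m → (∀ z, A v z → z = m) → ¬ L' u m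

/-- Configurations avoiding the new edge are inherited, because legality only shrinks. Those using
it are covered by the old invariant or by `Repaired` at `u` and at `v`. -/
theorem Inv.extend (P : Position A L) (I : Inv A L) (P' : Position A' L') (h : L u v)
    (hA : ∀ x y, A' x y ↔ A x y ∨ (x = u ∧ y = v) ∨ (x = v ∧ y = u))
    (hL : ∀ x y, L' x y → L x y) (R : Repaired A L' u v) (S : Repaired A L' v u) :
    Inv A' L' := by
  have huv : ¬ A u v := P.notA h
  have hvu : ¬ A v u := fun h' => huv (P.symmA h')
  have ne : u ≠ v := P.neL h
  have sA := @Position.symmA _ _ _ P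
  have nA : ∀ x, ¬ A x x := fun x h => P.neA h rfl
  have nL : ∀ x, ¬ L' x x := fun x h => P'.neL h rfl
  have sL := @Position.symmL _ _ _ P'
  have hh : ∀ {x y}, A x y → A' x y := fun h => (hA _ _).2 (Or.inl h)
  refine ⟨?_, ?_, ?_, ?_, ?_, ?_, ?_, ?_⟩
  -- A new diamond has `uv` as its shared edge, against `i1`, or as an outer edge, against `t2`;
  -- Blocker's reply plays no role here.
  · have t := @Inv.t2 _ _ _ I
    have i := @Inv.i1 _ _ _ I
    have d := @Inv.d _ _ _ I
    have h' := P.symmL h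
    intro a b c d h1 h2 h3 h4 h5
    rw [hA] at h1 h2 h3 h4 h5
    clear hh hA hL R S I P P'
    grind only
  · have i := @Inv.i1 _ _ _ I
    have i' := @Repaired.i1 _ _ _ _ _ R
    have i'' := @Repaired.i1 _ _ _ _ _ S
    intro x y c d h0 h1 h2 h3 h4
    have := hL _ _ h0
    rw [hA] at h1 h2 h3 h4
    clear hh hA hL R S I P P'
    grind only
  · intro a b c h1 h2 h3
    have t := @Inv.t1 _ _ _ I
    -- For the new triangle on `c`, a third neighbour of `c` serves as witness; if there is none,
    -- `j2` supplies one.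
    have key : ∀ c, A c u → A c v →
        ∃ w, w ≠ u ∧ w ≠ v ∧ w ≠ c ∧ (A u w ∨ A v w ∨ A c w) := by
      intro c hu hv
      by_cases hc : ∀ z, A c z → z = u ∨ z = v
      · obtain ⟨w, hw⟩ := I.j2 hu hv h hc
        exact ⟨w, by grind only⟩
      · push Not at hc
        obtain ⟨w, hw⟩ := hc
        exact ⟨w, by grind only⟩
    by_cases ho : A a b ∧ A b c ∧ A a c
    · obtain ⟨w, hw⟩ := t ho.1 ho.2.1 ho.2.2
      exact ⟨w, by grind only⟩
    · have : ∃ w, w ≠ a ∧ w ≠ b ∧ w ≠ c ∧ (A a w ∨ A b w ∨ A c w) := by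
        rw [hA] at h1 h2 h3
        clear hh hA hL R S I P P' t
        rcases h1 with h1 | ⟨rfl, rfl⟩ | ⟨rfl, rfl⟩
        · rcases h2 with h2 | ⟨rfl, rfl⟩ | ⟨rfl, rfl⟩
          · have := key b
            grind only
          · have := key a
            grind only
          · have := key a
            grind only
        · have := key c
          grind only
        · have := key c
          grind only
      obtain ⟨w, hw⟩ := this
      exact ⟨w, by grind only⟩
  · intro a b c w h1 h2 h3 h4 h5 h6 h7
    have t := @Inv.t2 _ _ _ I
    have := hL _ _ h7
    obtain ⟨a1, a2, a3, -, -, -, -, -, -⟩ := R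
    obtain ⟨b1, b2, b3, -, -, -, -, -, -⟩ := S
    rw [hA] at h1 h2 h3 h4
    clear hh hA hL  I P P'
    grind only
  · intro c x y h1 h2 h3 h4
    have j := @Inv.j2 _ _ _ I (c := c) (x := x) (y := y)
    have := hL _ _ h3
    obtain ⟨-, -, -, -, a1, -, -, -, -⟩ := R
    obtain ⟨-, -, -, -, b1, -, -, -, -⟩ := S
    have hw : ∀ w, L' w c → L w c := fun w => hL w c
    rw [hA] at h1 h2
    simp only [hA] at h4 ⊢
    clear I P P' hA hL
    by_cases ho : A c x ∧ A c y
    · obtain ⟨w, hw⟩ := j ho.1 ho.2 this (fun z hz => h4 z (Or.inl hz))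
      exact ⟨w, by grind only⟩
    · have hv : c = u ∨ c = v := by grind only
      rcases hv with rfl | rfl
      · by_cases hx : A c x
        · have := a1 hx (by grind only)
          grind only
        · have := @a1 y
          grind only
      · by_cases hx : A c x
        · have := b1 hx (by grind only)
          grind only
        · have := @b1 y
          grind only
  · intro c x y z h1 h2 h3 h4 h5 h6
    have j := @Inv.j3a _ _ _ I (c := c) (x := x) (y := y) (z := z)
    obtain ⟨-, -, -, -, -, a1, -, -, -⟩ := R
    obtain ⟨-, -, -, -, -, b1, -, -, -⟩ := S
    have := hL _ _ h4
    have := hL _ _ h5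
    have := hL _ _ h6
    rw [hA] at h1 h2 h3
    clear hh hA hL I P P'
    grind only
  · intro c x y z h1 h2 h3 h4 h5 h6
    have j := @Inv.j3b _ _ _ I c x y z
    obtain ⟨-, -, -, -, -, -, a1, a2, -⟩ := R
    obtain ⟨-, -, -, -, -, -, b1, b2, -⟩ := S
    have l1 := hL _ _ h5
    have l2 := hL _ _ h6
    suffices (∃ w, w ≠ c ∧ A x w) ∨
      ((∃ w, w ≠ c ∧ A y w ∧ ¬ L' w x) ∧ (∃ w, w ≠ c ∧ A z w ∧ ¬ L' w x)) by
      rcases this with ⟨w, p, q⟩ | ⟨⟨w, p, q, r⟩, ⟨t, p', q', r'⟩⟩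
      · exact Or.inl ⟨w, p, hh q⟩
      · exact Or.inr ⟨⟨w, p, hh q, r⟩, ⟨t, p', hh q', r'⟩⟩
    by_cases ho : A c x ∧ A c y ∧ A c z
    · rcases j ho.1 ho.2.1 ho.2.2 h4 l1 l2 with hw | ⟨⟨w, p, q, r⟩, ⟨t, p', q', r'⟩⟩
      · exact Or.inl hw
      · exact Or.inr ⟨⟨w, p, q, fun h => r (hL _ _ h)⟩, ⟨t, p', q', fun h => r' (hL _ _ h)⟩⟩
    · rw [hA] at h1 h2 h3
      have hv : c = u ∨ c = v := by grind only
      clear I P P' hA hL j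
      rcases hv with rfl | rfl
      · by_cases hx : A c x
        · by_cases hy : A c y
          · have := @a2 x y
            grind only
          · have := @a2 x z
            grind only
        · have := @a1 y z
          grind only
      · by_cases hx : A c x
        · by_cases hy : A c y
          · have := @b2 x y
            grind only
          · have := @b2 x z
            grind only
        · have := @b1 y z
          grind only
  -- If the new edge is an end edge of the path, `Repaired.k` applies. If it is a middle edge, the
  -- old component was a cherry without the outside neighbour that `j2` demands.
  · intro a b m d e h1 h2 h3 h4 h5 h6 h7 h8 h9 h10 h11 h12
    have k := @Inv.k _ _ _ I a b m d e
    have := hL _ _ h11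
    have := hL _ _ h12
    have a1 := @Repaired.k _ _ _ _ _ R
    have b1 := @Repaired.k _ _ _ _ _ S
    have j1 := @Inv.j2 _ _ _ I b a m
    have j2 := @Inv.j2 _ _ _ I d m e
    rw [hA] at h1 h2 h3 h4
    simp only [hA] at h6 h7 h8 h9 h10
    clear I P P' hL R S hA hh
    by_cases c1 : A a b
    · by_cases c2 : A b m
      · by_cases c3 : A m d
        · by_cases c4 : A d e
          · clear a1 b1 j1 j2
            grind only
          · clear k j1 j2
            have := @a1 m
            have := @b1 m
            grind only
        · clear k a1 b1 j2
          grind only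
      · clear k a1 b1 j1
        grind only
    · clear k j1 j2
      have := @a1 m
      have := @b1 m
      grind only
end ConstructorBlocker

/-! ### Which edges must be dead after the reply, case by case -/

namespace ConstructorBlocker
variable {V : Type*} {A L A' L' : V → V → Prop} {u v : V}

theorem Position.not_live_of_three (P' : Position A' L') {x a b c : V} (ha : A' x a) (hb : A' x b)
    (hc : A' x c) (hab : a ≠ b) (hac : a ≠ c) (hbc : b ≠ c) (z : V) : ¬ L' x z := fun h => by
  rcases P'.low h ha hb hc with h | h | h
  exacts [hab h, hac h, hbc h]

section
variable (P : Position A L) (I : Inv A L) (P' : Position A' L') (h : L u v)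
  (hA : ∀ x y, A' x y ↔ A x y ∨ (x = u ∧ y = v) ∨ (x = v ∧ y = u))
  (hL : ∀ x y, L' x y → L x y)
include P I P' h hA hL

theorem Inv.extend_of_isolated (hu : ∀ z, ¬ A u z) (hv : ∀ z, ¬ A v z) : Inv A' L' := by
  apply I.extend P P' h hA hL <;> constructor <;> grind only

theorem Inv.extend_of_saturated {a b c d : V} (ha : A u a) (hb : A u b) (hc : A v c) (hd : A v d)
    (hab : a ≠ b) (hcd : c ≠ d)
    (ht : ∀ x z, A u x → A v x → A u z ∨ A v z → ¬ L' x z) : Inv A' L' := by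
  have s1 : ∀ z, ¬ L' u z := P'.not_live_of_three ((hA _ _).2 (.inl ha)) ((hA _ _).2 (.inl hb))
    ((hA u v).2 (by simp)) hab (fun e => P.notA h (e ▸ ha)) (fun e => P.notA h (e ▸ hb))
  have s2 : ∀ z, ¬ L' v z := P'.not_live_of_three ((hA _ _).2 (.inl hc)) ((hA _ _).2 (.inl hd))
    ((hA v u).2 (by simp)) hcd (fun e => P.notA (P.symmL h) (e ▸ hc))
    (fun e => P.notA (P.symmL h) (e ▸ hd))
  have j := @Inv.j3a _ _ _ I
  have t := @Inv.t2 _ _ _ I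
  have sL := @Position.symmL _ _ _ P
  have sL' := @Position.symmL _ _ _ P'
  have sA := @Position.symmA _ _ _ P
  have i := @Inv.i1 _ _ _ I
  have lo := @Position.low _ _ _ P
  apply I.extend P P' h hA hL <;> constructor
  all_goals clear P I P'
  all_goals grind only

theorem Inv.extend_of_leaf {x : V} (hu : ∀ z, A u z ↔ z = x) (hv : ∀ z, ¬ A v z)
    (hb : ¬ L' v x) : Inv A' L' := by
  have sL' := @Position.symmL _ _ _ P'
  have nA := @Position.neA _ _ _ P
  have nL := @Position.notA _ _ _ P
  have nL' : ∀ x, ¬ L' x x := fun x h => P'.neL h rfl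
  have sL0 := @Position.symmL _ _ _ P
  apply I.extend P P' h hA hL <;> constructor
  all_goals clear P I P'
  all_goals grind only

/-- On the path `x u v y` the threat `uy` may survive: its triangle has the outside neighbour `x` at
`u`, and the dead edge `vx` makes this the witness for `j2`. -/
theorem Inv.extend_of_path {x y : V} (hu : ∀ z, A u z ↔ z = x) (hv : ∀ z, A v z ↔ z = y)
    (hxy : x ≠ y) (hn : ¬ A x y) (hb : ¬ L' v x) : Inv A' L' := by
  have hux := (hu x).2 rfl
  have hvy := (hv y).2 rfl
  have sL' := @Position.symmL _ _ _ P'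
  have nA := @Position.neA _ _ _ P
  have nL := @Position.notA _ _ _ P
  have nL' : ∀ x, ¬ L' x x := fun x h => P'.neL h rfl
  have sL0 := @Position.symmL _ _ _ P
  have sA := @Position.symmA _ _ _ P
  apply I.extend P P' h hA hL <;> constructor
  all_goals clear P I P'
  all_goals grind only

theorem Inv.extend_of_path_of_not_live {x y : V} (hu : ∀ z, A u z ↔ z = x) (hv : ∀ z, A v z ↔ z = y)
    (hxy : x ≠ y) (hb : ¬ L' v x) (hb' : ¬ L' u y) : Inv A' L' := by
  have sL' := @Position.symmL _ _ _ P'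
  have nA := @Position.neA _ _ _ P
  have nL := @Position.notA _ _ _ P
  have nL' : ∀ x, ¬ L' x x := fun x h => P'.neL h rfl
  have sL0 := @Position.symmL _ _ _ P
  have sA := @Position.symmA _ _ _ P
  apply I.extend P P' h hA hL <;> constructor
  all_goals clear P I P'
  all_goals grind only


/-- The triangle `u v c` appears and `u` is saturated. The remaining danger `cw` was already dead:
were it legal, `c` would have only the neighbours `u` and `v`, and `j2` would fail. -/
theorem Inv.extend_of_triangle_leaf {c w : V} (hu : ∀ z, A u z ↔ z = c ∨ z = w) (hcw : c ≠ w)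
    (hv : ∀ z, A v z ↔ z = c) (hb : ¬ L' v w)
    (hz : ∀ z, A c z → z ≠ u → z ≠ v → ¬ L' v z) : Inv A' L' := by
  have huc := (hu c).2 (.inl rfl)
  have huw := (hu w).2 (.inr rfl)
  have hvc := (hv c).2 rfl
  have s1 : ∀ z, ¬ L' u z := P'.not_live_of_three ((hA _ _).2 (.inl huc)) ((hA _ _).2 (.inl huw))
    ((hA u v).2 (by simp)) hcw (fun e => P.notA h (e ▸ huc)) (fun e => P.notA h (e ▸ huw))
  have sL := @Position.symmL _ _ _ P
  have sL' := @Position.symmL _ _ _ P'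
  have nA := @Position.neA _ _ _ P
  have nL := @Position.notA _ _ _ P
  have nL' : ∀ x, ¬ L' x x := fun x h => P'.neL h rfl
  have sL0 := @Position.symmL _ _ _ P
  have sA := @Position.symmA _ _ _ P
  have lo := @Position.low _ _ _ P c
  have j := I.j2 (sA huc) (sA hvc) h
  have dead : ¬ L c w := fun hl => by
    have hc : ∀ z, A c z → z = u ∨ z = v := by grind only
    have := j hc
    grind only
  have j3 := @Inv.j3b _ _ _ I
  apply I.extend P P' h hA hL <;> constructor
  all_goals clear P I P' j
  all_goals grind only

theorem Inv.extend_of_triangle_leaves {c : V} (hu : ∀ z, A u z ↔ z = c)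
    (hv : ∀ z, A v z ↔ z = c)
    (hz : ∀ z, A c z → z ≠ u → z ≠ v → ¬ L' u z ∧ ¬ L' v z) : Inv A' L' := by
  have huc := (hu c).2 rfl
  have hvc := (hv c).2 rfl
  have sL' := @Position.symmL _ _ _ P'
  have nA := @Position.neA _ _ _ P
  have nL := @Position.notA _ _ _ P
  have nL' : ∀ x, ¬ L' x x := fun x h => P'.neL h rfl
  have sL0 := @Position.symmL _ _ _ P
  have sA := @Position.symmA _ _ _ P
  apply I.extend P P' h hA hL <;> constructor
  all_goals clear P I P'
  all_goals grind only

theorem Inv.extend_of_pendant {x y : V} (hu : ∀ z, A u z ↔ z = x ∨ z = y)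
    (hv : ∀ a b, A v a → A v b → a = b) (hxy : A x y) (hvx : ¬ A v x) (hvy : ¬ A v y)
    (bx : ¬ L' v x) (hby : ¬ L' v y) : Inv A' L' := by
  have hux := (hu x).2 (.inl rfl)
  have huy := (hu y).2 (.inr rfl)
  have s1 : ∀ z, ¬ L' u z := P'.not_live_of_three ((hA _ _).2 (.inl hux)) ((hA _ _).2 (.inl huy))
    ((hA u v).2 (by simp)) (P.neA hxy) (fun e => P.notA h (e ▸ hux)) (fun e => P.notA h (e ▸ huy))
  have sL' := @Position.symmL _ _ _ P'
  have nA := @Position.neA _ _ _ P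
  have nL := @Position.notA _ _ _ P
  have nL' : ∀ x, ¬ L' x x := fun x h => P'.neL h rfl
  have sL0 := @Position.symmL _ _ _ P
  have sA := @Position.symmA _ _ _ P
  apply I.extend P P' h hA hL <;> constructor
  all_goals clear P I P'
  all_goals grind only

/-- With `xy` and `vx` dead, `vy` is the only possible threat inside the claw at `u`; `hd` keeps it
from having a second common neighbour. -/
theorem Inv.extend_of_claw {x y : V} (hu : ∀ z, A u z ↔ z = x ∨ z = y) (hne : x ≠ y)
    (hv : ∀ a b, A v a → A v b → a = b) (hxy : ¬ A x y) (hvx : ¬ A v x) (hvy : ¬ A v y)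
    (hl : ¬ L x y) (bx : ¬ L' v x) (hd : ∀ c, A v c → A c y → ¬ L' v y) : Inv A' L' := by
  have hux := (hu x).2 (.inl rfl)
  have huy := (hu y).2 (.inr rfl)
  have s1 : ∀ z, ¬ L' u z := P'.not_live_of_three ((hA _ _).2 (.inl hux)) ((hA _ _).2 (.inl huy))
    ((hA u v).2 (by simp)) hne (fun e => P.notA h (e ▸ hux)) (fun e => P.notA h (e ▸ huy))
  have sL' := @Position.symmL _ _ _ P'
  have nA := @Position.neA _ _ _ P
  have nL := @Position.notA _ _ _ P
  have nL' : ∀ x, ¬ L' x x := fun x h => P'.neL h rfl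
  have sL0 := @Position.symmL _ _ _ P
  have sA := @Position.symmA _ _ _ P
  apply I.extend P P' h hA hL <;> constructor
  all_goals clear P I P'
  all_goals grind only

/-- The surviving threats `xy` and `vx` meet in `x`, whose further neighbour `w` gives the first
alternative of `j3b`. -/
theorem Inv.extend_of_claw_live {x y w : V} (hu : ∀ z, A u z ↔ z = x ∨ z = y) (hne : x ≠ y)
    (hv : ∀ a b, A v a → A v b → a = b) (hxy : ¬ A x y) (hvx : ¬ A v x) (hvy : ¬ A v y)
    (hwu : w ≠ u) (hxw : A x w)
    (bx : ¬ L' v y) (hd : ∀ c, A v c → A c x → ¬ L' v x) : Inv A' L' := by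
  have hux := (hu x).2 (.inl rfl)
  have huy := (hu y).2 (.inr rfl)
  have s1 : ∀ z, ¬ L' u z := P'.not_live_of_three ((hA _ _).2 (.inl hux)) ((hA _ _).2 (.inl huy))
    ((hA u v).2 (by simp)) hne (fun e => P.notA h (e ▸ hux)) (fun e => P.notA h (e ▸ huy))
  have sL' := @Position.symmL _ _ _ P'
  have nA := @Position.neA _ _ _ P
  have nL := @Position.notA _ _ _ P
  have nL' : ∀ x, ¬ L' x x := fun x h => P'.neL h rfl
  have sL0 := @Position.symmL _ _ _ P
  have sA := @Position.symmA _ _ _ P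
  apply I.extend P P' h hA hL <;> constructor
  all_goals clear P I P'
  all_goals grind only

/-- The move closes the square `u v c x`, and killing its diagonal `vx` leaves `xy` and `vy`, which
meet in `y`. For `j3b`, either `y` has another neighbour or `c` witnesses for both `x` and `v`. -/
theorem Inv.extend_of_square {x y c : V} (hu : ∀ z, A u z ↔ z = x ∨ z = y) (hne : x ≠ y)
    (hv : ∀ a b, A v a → A v b → a = b) (hxy : ¬ A x y) (hvy : ¬ A v y)
    (hl : L x y) (hlv : L v x) (hvc : A v c) (hcx : A c x)
    (bx : ¬ L' v x) : Inv A' L' := by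
  have hux := (hu x).2 (.inl rfl)
  have huy := (hu y).2 (.inr rfl)
  have s1 : ∀ z, ¬ L' u z := P'.not_live_of_three ((hA _ _).2 (.inl hux)) ((hA _ _).2 (.inl huy))
    ((hA u v).2 (by simp)) hne (fun e => P.notA h (e ▸ hux)) (fun e => P.notA h (e ▸ huy))
  have sL' := @Position.symmL _ _ _ P'
  have nA := @Position.neA _ _ _ P
  have nL := @Position.notA _ _ _ P
  have nL' : ∀ x, ¬ L' x x := fun x h => P'.neL h rfl
  have sL0 := @Position.symmL _ _ _ P
  have sA := @Position.symmA _ _ _ P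
  have i := @Inv.i1 _ _ _ I x y u c hl (by grind) (by grind)
  -- Otherwise the old component was the path `v c x u y` with `vx` and `xy` legal, exactly what `k`
  -- forbids.
  have key : (∃ w, w ≠ u ∧ A y w) ∨ ¬ L c y := by
    by_contra! hcon
    obtain ⟨hy, hcy⟩ := hcon
    have l1 := @Position.low _ _ _ P c y
    have l2 := @Position.low _ _ _ P x y
    refine I.k hvc hcx (sA hux) huy ?_ ?_ ?_ ?_ ?_ ?_ hlv hl <;> grind only
  apply I.extend P P' h hA hL <;> constructor
  all_goals clear P I P'
  all_goals grind only

end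
end ConstructorBlocker

/-! ### Existence of a single sufficient reply -/

namespace ConstructorBlocker
variable {V : Type*} {A L A' L' : V → V → Prop} {u v : V}

/-- Blocker has a reply to the move `uv` that restores the invariant. -/
def Reply (A' L : V → V → Prop) : Prop :=
  ∃ p q, ∀ L' : V → V → Prop, Position A' L' → (∀ x y, L' x y → L x y) → ¬ L' p q → Inv A' L'

theorem Position.neighbors (P : Position A L) (h : L u v) :
    (∀ z, ¬ A u z) ∨ (∃ x, ∀ z, A u z ↔ z = x) ∨
      ∃ x y, x ≠ y ∧ ∀ z, A u z ↔ z = x ∨ z = y := by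
  have lo := @Position.low _ _ _ P u v
  by_cases h0 : ∀ z, ¬ A u z
  · exact .inl h0
  push Not at h0
  obtain ⟨x, hx⟩ := h0
  by_cases h1 : ∃ y, y ≠ x ∧ A u y
  · obtain ⟨y, hy, hy'⟩ := h1
    refine .inr (.inr ⟨x, y, hy.symm, fun z => ⟨fun hz => ?_, ?_⟩⟩)
    · grind
    · rintro (rfl | rfl) <;> assumption
  · refine .inr (.inl ⟨x, fun z => ⟨fun hz => ?_, ?_⟩⟩)
    · grind
    · rintro rfl; assumption

section
variable (P : Position A L) (I : Inv A L) (h : L u v)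
  (hA : ∀ x y, A' x y ↔ A x y ∨ (x = u ∧ y = v) ∨ (x = v ∧ y = u))
include P I h hA

theorem Inv.reply_claw {x y : V} (hu : ∀ z, A u z ↔ z = x ∨ z = y) (hne : x ≠ y)
    (hv : ∀ a b, A v a → A v b → a = b) (hvx : ¬ A v x) (hvy : ¬ A v y) : Reply A' L := by
  have hux := (hu x).2 (.inl rfl)
  have huy := (hu y).2 (.inr rfl)
  have hu' : ∀ z, A u z ↔ z = y ∨ z = x := fun z => (hu z).trans or_comm
  have sA := @Position.symmA _ _ _ P
  have sL := @Position.symmL _ _ _ P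
  by_cases hxy : A x y
  -- The outside neighbour from `t1` is not at `u`, so it saturates `x` or `y`.
  · have : ¬ L v x ∨ ¬ L v y := by
      obtain ⟨w, hw⟩ := I.t1 hux hxy huy
      have l1 := @Position.low _ _ _ P x v
      have l2 := @Position.low _ _ _ P y v
      have nA := @Position.neA _ _ _ P
      grind only
    rcases this with hn | hn
    · exact ⟨v, y, fun L' P' hL hb =>
        I.extend_of_pendant P P' h hA hL hu hv hxy hvx hvy (fun h => hn (hL _ _ h)) hb⟩
    · exact ⟨v, x, fun L' P' hL hb =>
        I.extend_of_pendant P P' h hA hL hu hv hxy hvx hvy hb (fun h => hn (hL _ _ h))⟩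
  have hyx : ¬ A y x := fun h => hxy (sA h)
  by_cases hl : L x y
  · have key : ∀ x y, (∀ z, A u z ↔ z = x ∨ z = y) → x ≠ y → ¬ A v x → ¬ A v y → ¬ A x y →
        L x y → ∀ w, w ≠ u → A x w → Reply A' L := by
      intro x y hu hne hvx hvy hxy hl w hw hxw
      by_cases hd : ∃ c, A v c ∧ A c x ∧ L v x
      · obtain ⟨c, hc, hcx, hvl⟩ := hd
        exact ⟨v, x, fun L' P' hL hb =>
          I.extend_of_square P P' h hA hL hu hne hv hxy hvy hl hvl hc hcx hb⟩
      · exact ⟨v, y, fun L' P' hL hb =>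
          I.extend_of_claw_live P P' h hA hL hu hne hv hxy hvx hvy hw hxw hb
            fun c h1 h2 h3 => hd ⟨c, h1, h2, hL _ _ h3⟩⟩
    obtain ⟨w, hw, hw' | hw', -⟩ := I.j2 hux huy hl fun z => (hu z).1
    · exact key x y hu hne hvx hvy hxy hl w hw hw'
    · exact key y x hu' hne.symm hvy hvx hyx (sL hl) w hw hw'
  · by_cases hd : ∃ c, A v c ∧ A c x ∧ L v x
    · obtain ⟨c, hc, hcx, hvl⟩ := hd
      refine ⟨v, x, fun L' P' hL hb =>
        I.extend_of_claw P P' h hA hL hu hne hv hxy hvx hvy hl hb fun c' h1 h2 h3 => ?_⟩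
      -- If `vy` were legal too, `j3b` at `c` would need a neighbour of `x` other than `c` with no
      -- legal edge to `v`; the only candidate is `u`, and `uv` was legal.
      obtain rfl := hv _ _ hc h1
      have l1 := @Position.low _ _ _ P x v
      have := I.j3b (sA hc) hcx h2 hne hvl (hL _ _ h3)
      have hn := P.notA (sL h)
      grind only
    · exact ⟨v, y, fun L' P' hL hb =>
        I.extend_of_claw P P' h hA hL hu' hne.symm hv hyx hvy hvx (fun h => hl (sL h)) hb
          fun c h1 h2 h3 => hd ⟨c, h1, h2, hL _ _ h3⟩⟩

theorem Inv.reply_path {x y : V} (hu : ∀ z, A u z ↔ z = x) (hv : ∀ z, A v z ↔ z = y)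
    (hne : x ≠ y) : Reply A' L := by
  by_cases hxy : A x y
  -- The move closes a square. If both diagonals were legal, the only outside neighbour available
  -- for `j2` at `x` would be `v`, contradicting the legality of `vx`.
  · have : ¬ L v x ∨ ¬ L u y := by
      have hux := (hu x).2 rfl
      have hvy := (hv y).2 rfl
      have sA := @Position.symmA _ _ _ P
      have sL := @Position.symmL _ _ _ P
      by_contra! hcon
      have lo := @Position.low _ _ _ P x v
      have := I.j2 (sA hux) hxy hcon.2
      have lo' := @Position.low _ _ _ P y u
      have nL := @Position.neL _ _ _ P
      grind only
    rcases this with hn | hn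
    · exact ⟨u, y, fun L' P' hL hb =>
        I.extend_of_path_of_not_live P P' h hA hL hu hv hne (fun h => hn (hL _ _ h)) hb⟩
    · exact ⟨v, x, fun L' P' hL hb =>
        I.extend_of_path_of_not_live P P' h hA hL hu hv hne hb (fun h => hn (hL _ _ h))⟩
  · exact ⟨v, x, fun L' P' hL hb => I.extend_of_path P P' h hA hL hu hv hne hxy hb⟩

theorem Inv.reply_triangle_leaf {c w : V} (hu : ∀ z, A u z ↔ z = c ∨ z = w) (hcw : c ≠ w)
    (hv : ∀ z, A v z ↔ z = c) : Reply A' L := by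
  have huc := (hu c).2 (.inl rfl)
  have hvc := (hv c).2 rfl
  have sA := @Position.symmA _ _ _ P
  have sL := @Position.symmL _ _ _ P
  by_cases hz : ∃ z, A c z ∧ z ≠ u ∧ z ≠ v ∧ L v z
  · obtain ⟨z, h1, h2, h3, h4⟩ := hz
    refine ⟨v, z, fun L' P' hL hb =>
      I.extend_of_triangle_leaf P P' h hA hL hu hcw hv (fun h' => ?_) fun y hy h5 h6 h7 => ?_⟩
    -- Since `v` is a leaf, `j3b` at `c` says that `vw` was already dead, so blocking `vz` suffices.
    · have := I.j3b (sA hvc) (sA huc) h1 h2.symm (sL h) h4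
      have := hL _ _ h'
      have lo := fun a b c => @Position.low _ _ _ P u v a b c h
      have nA := @Position.neA _ _ _ P
      grind only
    · have := P.deg hy h1 (sA huc) (sA hvc)
      have := P.neL h
      grind only
  · exact ⟨v, w, fun L' P' hL hb =>
      I.extend_of_triangle_leaf P P' h hA hL hu hcw hv hb
        fun y hy h5 h6 h7 => hz ⟨y, hy, h5, h6, hL _ _ h7⟩⟩

theorem Inv.reply_triangle_leaves {c : V} (hu : ∀ z, A u z ↔ z = c)
    (hv : ∀ z, A v z ↔ z = c) : Reply A' L := by
  have huc := P.symmA ((hu c).2 rfl)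
  have hvc := P.symmA ((hv c).2 rfl)
  have nuv := P.neL h
  by_cases hz : ∃ z, A c z ∧ z ≠ u ∧ z ≠ v
  · obtain ⟨z, h1, h2, h3⟩ := hz
    have huniq : ∀ y, A c y → y ≠ u → y ≠ v → y = z := by
      intro y hy h5 h6
      have := P.deg hy h1 huc hvc
      grind only
    have : ¬ L u z ∨ ¬ L v z := by
      by_contra! hcon
      exact I.j3a huc hvc h1 h hcon.1 hcon.2
    rcases this with hn | hn
    · refine ⟨v, z, fun L' P' hL hb =>
        I.extend_of_triangle_leaves P P' h hA hL hu hv fun y hy h5 h6 => ?_⟩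
      obtain rfl := huniq y hy h5 h6
      exact ⟨fun h => hn (hL _ _ h), hb⟩
    · refine ⟨u, z, fun L' P' hL hb =>
        I.extend_of_triangle_leaves P P' h hA hL hu hv fun y hy h5 h6 => ?_⟩
      obtain rfl := huniq y hy h5 h6
      exact ⟨hb, fun h => hn (hL _ _ h)⟩
  · exact ⟨u, v, fun L' P' hL hb =>
      I.extend_of_triangle_leaves P P' h hA hL hu hv fun y hy h5 h6 => (hz ⟨y, hy, h5, h6⟩).elim⟩

theorem Inv.reply_saturated {a b c d : V} (hu : ∀ z, A u z ↔ z = a ∨ z = b) (hab : a ≠ b)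
    (hv : ∀ z, A v z ↔ z = c ∨ z = d) (hcd : c ≠ d) : Reply A' L := by
  have sA := @Position.symmA _ _ _ P
  have nA := @Position.neA _ _ _ P
  by_cases ht : ∃ x z, A u x ∧ A v x ∧ (A u z ∨ A v z) ∧ L x z
  · obtain ⟨x, z, h1, h2, h3, h4⟩ := ht
    refine ⟨x, z, fun L' P' hL hb =>
      I.extend_of_saturated P P' h hA hL ((hu a).2 (.inl rfl)) ((hu b).2 (.inr rfl))
        ((hv c).2 (.inl rfl)) ((hv d).2 (.inr rfl)) hab hcd fun x' z' h5 h6 h7 h8 => ?_⟩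
    -- The apex is unique by `i1` and has only the neighbours `u` and `v`. By `j2`, one of its two
    -- possible dangerous edges was already dead, so one block suffices.
    obtain rfl := I.i1 h (sA h1) (sA h2) (sA h5) (sA h6)
    have h8' := hL _ _ h8
    have lo := fun a b c => @Position.low _ _ _ P x z a b c h4
    have := I.j2 (sA h1) (sA h2) h
    have sL := @Position.symmL _ _ _ P
    have nL := @Position.neL _ _ _ P
    grind only
  · refine ⟨u, v, fun L' P' hL hb =>
      I.extend_of_saturated P P' h hA hL ((hu a).2 (.inl rfl)) ((hu b).2 (.inr rfl))
        ((hv c).2 (.inl rfl)) ((hv d).2 (.inr rfl)) hab hcd fun x z h5 h6 h7 h8 =>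
          ht ⟨x, z, h5, h6, h7, hL _ _ h8⟩⟩

theorem Inv.reply_leaf {x : V} (hu : ∀ z, A u z ↔ z = x) (hv : ∀ z, ¬ A v z) : Reply A' L :=
  ⟨v, x, fun _ P' hL hb => I.extend_of_leaf P P' h hA hL hu hv hb⟩

theorem Inv.reply_two {x y : V} (hu : ∀ z, A u z ↔ z = x ∨ z = y) (hne : x ≠ y)
    (hv : ∀ a b, A v a → A v b → a = b) : Reply A' L := by
  by_cases hx : A v x
  · exact I.reply_triangle_leaf P h hA hu hne fun z => ⟨fun hz => hv _ _ hz hx, fun e => e ▸ hx⟩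
  by_cases hy : A v y
  · exact I.reply_triangle_leaf P h hA (fun z => (hu z).trans or_comm) hne.symm
      fun z => ⟨fun hz => hv _ _ hz hy, fun e => e ▸ hy⟩
  exact I.reply_claw P h hA hu hne hv hx hy

theorem Inv.reply : Reply A' L := by
  have hA' : ∀ x y, A' x y ↔ A x y ∨ (x = v ∧ y = u) ∨ (x = u ∧ y = v) := fun x y =>
    (hA x y).trans (or_congr_right or_comm)
  have h' := P.symmL h
  rcases P.neighbors h with hu | ⟨x, hu⟩ | ⟨x, y, hne, hu⟩ <;>
  rcases P.neighbors h' with hv | ⟨c, hv⟩ | ⟨c, d, hne', hv⟩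
  · exact ⟨u, v, fun _ P' hL _ => I.extend_of_isolated P P' h hA hL hu hv⟩
  · exact I.reply_leaf P h' hA' hv hu
  · exact I.reply_two P h' hA' hv hne' fun a b ha => (hu a ha).elim
  · exact I.reply_leaf P h hA hu hv
  · by_cases e : x = c
    · subst e
      exact I.reply_triangle_leaves P h hA hu hv
    · exact I.reply_path P h hA hu hv e
  · exact I.reply_two P h' hA' hv hne' fun a b ha hb => ((hu a).1 ha).trans ((hu b).1 hb).symm
  · exact I.reply_two P h hA hu hne fun a b ha => (hv a ha).elim
  · exact I.reply_two P h hA hu hne fun a b ha hb => ((hv a).1 ha).trans ((hv b).1 hb).symm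
  · exact I.reply_saturated P h hA hu hne hv hne'
end
end ConstructorBlocker

/-! ### From the invariant to the upper bound -/

namespace ConstructorBlocker
open SimpleGraph

theorem starS_four_free_iff {V : Type*} {G : SimpleGraph V} : (starS 4).Free G ↔
    ∀ x a b c d : V, G.Adj x a → G.Adj x b → G.Adj x c → G.Adj x d →
      a = b ∨ a = c ∨ a = d ∨ b = c ∨ b = d ∨ c = d := by
  constructor
  · intro h x a b c d ha hb hc hd
    by_contra! hcon
    refine h ⟨⟨⟨![x, a, b, c, d], ?_⟩, ?_⟩⟩
    · intro i j hij
      rw [starGraph_adj] at hij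
      obtain ⟨hne, rfl | rfl⟩ := hij
      · fin_cases j <;> simp_all
      · fin_cases i <;> simp_all [G.adj_comm]
    · have := ha.ne
      have := hb.ne
      have := hc.ne
      have := hd.ne
      intro i j hij
      fin_cases i <;> fin_cases j <;> simp_all
  · rintro h ⟨f⟩
    have adj : ∀ i : Fin 5, i ≠ 0 → G.Adj (f 0) (f i) := fun i hi =>
      f.toHom.map_adj (starGraph_center_adj hi.symm)
    have := h _ _ _ _ _ (adj 1 (by decide)) (adj 2 (by decide)) (adj 3 (by decide)) (adj 4 (by decide))
    have inj : ∀ i j, f i = f j ↔ i = j := fun i j => f.injective.eq_iff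
    simp only [inj] at this
    revert this
    decide

-- A subgraph isomorphic to a complete graph is determined by its vertex set, which is a clique.
open Classical in
theorem copyCount_completeGraph {V : Type*} [Fintype V] (G : SimpleGraph V) (k : ℕ) :
    G.copyCount (completeGraph (Fin k)) = (G.cliqueFinset k).card := by
  rw [copyCount]
  have adj : ∀ {G' : G.Subgraph}, Nonempty (completeGraph (Fin k) ≃g G'.coe) →
      ∀ {x y}, x ∈ G'.verts → y ∈ G'.verts → x ≠ y → G'.Adj x y := by
    rintro G' ⟨e⟩ x y hx hy hxy
    have : G'.coe.Adj ⟨x, hx⟩ ⟨y, hy⟩ := by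
      rw [← e.symm.map_adj_iff]
      simpa using hxy
    simpa using this
  refine Finset.card_nbij (fun G' => G'.verts.toFinset) ?_ ?_ ?_
  · intro G' hG'
    simp only [Finset.coe_filter, Finset.mem_univ, true_and, Set.mem_ofPred_eq] at hG'
    rw [Finset.mem_coe, mem_cliqueFinset_iff, isNClique_iff]
    refine ⟨?_, ?_⟩
    · intro x hx y hy hxy
      simp only [Set.coe_toFinset] at hx hy
      exact (adj hG' hx hy hxy).adj_sub
    · obtain ⟨e⟩ := hG'
      rw [Set.toFinset_card]
      simpa using (Fintype.card_congr e.toEquiv).symm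
  · intro G₁ h₁ G₂ h₂ h
    simp only [Finset.coe_filter, Finset.mem_univ, true_and, Set.mem_ofPred_eq] at h₁ h₂
    have h : G₁.verts = G₂.verts := by simpa using h
    refine Subgraph.ext h ?_
    ext x y
    constructor
    · intro hxy
      exact adj h₂ (h ▸ hxy.fst_mem) (h ▸ hxy.snd_mem) hxy.ne
    · intro hxy
      exact adj h₁ (h ▸ hxy.fst_mem) (h ▸ hxy.snd_mem) hxy.ne
  · intro s hs
    rw [Finset.mem_coe, mem_cliqueFinset_iff, isNClique_iff] at hs
    refine ⟨(⊤ : G.Subgraph).induce s, ?_, by simp⟩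
    simp only [Finset.coe_filter, Finset.mem_univ, true_and, Set.mem_ofPred_eq]
    let e : Fin k ≃ ((⊤ : G.Subgraph).induce s).verts := (Finset.equivFinOfCardEq hs.2).symm
    refine ⟨⟨e, ?_⟩⟩
    intro i j
    have hi : (e i : V) ∈ s := (e i).2
    have hj : (e j : V) ∈ s := (e j).2
    simp only [Subgraph.coe_adj, Subgraph.induce_adj, Finset.mem_coe, hi, hj, Subgraph.top_adj,
      true_and, top_adj]
    constructor
    · rintro h rfl
      exact h.ne rfl
    · intro h
      exact hs.1 hi hj fun h' => h (e.injective (Subtype.ext h'))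

-- Two triangles through `x` use two neighbours of `x` each out of at most three, hence share an
-- edge, and `hd` identifies them. Thus triangles are disjoint as vertex sets.
open Classical in
theorem three_mul_copyCount_le {V : Type*} [Fintype V] {G : SimpleGraph V}
    (hf : (starS 4).Free G)
    (hd : ∀ {a b c d}, G.Adj a b → G.Adj a c → G.Adj b c → G.Adj a d → G.Adj b d → c = d) :
    3 * G.copyCount (completeGraph (Fin 3)) ≤ Fintype.card V := by
  have deg := starS_four_free_iff.1 hf
  rw [copyCount_completeGraph, mul_comm]
  have : (G.cliqueFinset 3).card * 3 = ((G.cliqueFinset 3).biUnion id).card := by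
    rw [Finset.card_biUnion, Finset.sum_const_nat]
    · intro s hs
      exact ((mem_cliqueFinset_iff ..).1 hs).card_eq
    · intro s hs t ht hst
      rw [Finset.mem_coe, mem_cliqueFinset_iff] at hs ht
      simp only [Function.onFun, id]
      rw [Finset.disjoint_left]
      intro x hxs hxt
      refine hst ?_
      obtain ⟨a, b, hxa, hxb, hab, rfl⟩ : ∃ a b, G.Adj x a ∧ G.Adj x b ∧ G.Adj a b ∧
          s = {x, a, b} := by
        obtain ⟨p, q, r, h1, h2, h3, rfl⟩ := is3Clique_iff.1 hs
        simp only [Finset.mem_insert, Finset.mem_singleton] at hxs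
        rcases hxs with rfl | rfl | rfl
        · exact ⟨q, r, h1, h2, h3, rfl⟩
        · exact ⟨p, r, h1.symm, h3, h2, Finset.insert_comm ..⟩
        · exact ⟨p, q, h2.symm, h3.symm, h1, by ext; simp; tauto⟩
      obtain ⟨c, d, hxc, hxd, hcd, rfl⟩ : ∃ a b, G.Adj x a ∧ G.Adj x b ∧ G.Adj a b ∧
          t = {x, a, b} := by
        obtain ⟨p, q, r, h1, h2, h3, rfl⟩ := is3Clique_iff.1 ht
        simp only [Finset.mem_insert, Finset.mem_singleton] at hxt
        rcases hxt with rfl | rfl | rfl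
        · exact ⟨q, r, h1, h2, h3, rfl⟩
        · exact ⟨p, r, h1.symm, h3, h2, Finset.insert_comm ..⟩
        · exact ⟨p, q, h2.symm, h3.symm, h1, by ext; simp; tauto⟩
      have hab' := hab.ne
      have hcd' := hcd.ne
      rcases deg _ _ _ _ _ hxa hxb hxc hxd with h | h | h | h | h | h
      · exact (hab' h).elim
      · subst h
        rw [hd hxa hxb hab hxd hcd]
      · subst h
        rw [hd hxa hxb hab hxc hcd.symm]
        ext; simp; tauto
      · subst h
        rw [hd hxb hxa hab.symm hxd hcd]
        ext; simp; tauto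
      · subst h
        rw [hd hxb hxa hab.symm hxc hcd.symm]
      · exact (hcd' h).elim
  rw [this]
  exact Finset.card_le_univ _

section Graph
variable {V : Type*}

theorem graph_adj {C : Finset (Sym2 V)} {x y : V} :
    (graph C).Adj x y ↔ s(x, y) ∈ C ∧ x ≠ y := by
  simp [graph]

theorem graph_mono {C C' : Finset (Sym2 V)} (h : C ⊆ C') : graph C ≤ graph C' := by
  intro x y
  simp only [graph_adj]
  exact fun h' => ⟨h h'.1, h'.2⟩

end Graph

section Game
variable {V : Type*} [Fintype V] {α β : Type*}

theorem mem_freeEdges {C B : Finset (Sym2 V)} {x y : V} :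
    s(x, y) ∈ freeEdges C B ↔ x ≠ y ∧ s(x, y) ∉ C ∧ s(x, y) ∉ B := by
  simp [freeEdges]

theorem mem_legalEdges {F : SimpleGraph β} {C B : Finset (Sym2 V)} {e : Sym2 V} [DecidableEq V] :
    e ∈ legalEdges F C B ↔ e ∈ freeEdges C B ∧ F.Free (graph (insert e C)) := by
  classical
  rw [legalEdges, Finset.mem_filter]
  convert Iff.rfl

theorem legalEdges_anti {F : SimpleGraph β} {C C' B B' : Finset (Sym2 V)}
    (hC : C ⊆ C') (hB : B ⊆ B') : legalEdges F C' B' ⊆ legalEdges F C B := by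
  classical
  intro e
  rw [mem_legalEdges, mem_legalEdges]
  rintro ⟨h1, h2⟩
  refine ⟨?_, fun h => h2 (h.mono_right (graph_mono (Finset.insert_subset_insert _ hC)))⟩
  simp only [freeEdges, Finset.mem_filter] at h1 ⊢
  exact ⟨h1.1, h1.2.1, fun h => h1.2.2.1 (hC h), fun h => h1.2.2.2 (hB h)⟩

theorem position {C B : Finset (Sym2 V)} (hC : (starS 4).Free (graph C)) :
    Position (graph C).Adj (fun x y => s(x, y) ∈ legalEdges (starS 4) C B) := by
  classical
  have mem : ∀ {x y}, s(x, y) ∈ legalEdges (starS 4) C B → x ≠ y ∧ s(x, y) ∉ C :=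
    fun h => ⟨(mem_freeEdges.1 (mem_legalEdges.1 h).1).1,
      (mem_freeEdges.1 (mem_legalEdges.1 h).1).2.1⟩
  refine ⟨fun h => h.symm, fun h => h.ne, ?_, fun h => (mem h).1, ?_, ?_,
    starS_four_free_iff.1 hC _ _ _ _ _⟩
  · intro x y h
    rwa [Sym2.eq_swap]
  · intro x y h h'
    exact (mem h).2 (graph_adj.1 h').1
  · intro x y a b c h ha hb hc
    have hm := mem h
    have sub := graph_mono (Finset.subset_insert s(x, y) C)
    have hy : (graph (insert s(x, y) C)).Adj x y := graph_adj.2 ⟨Finset.mem_insert_self _ _, hm.1⟩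
    have ne : ∀ {z}, (graph C).Adj x z → z ≠ y := by
      rintro z hz rfl
      exact hm.2 (graph_adj.1 hz).1
    rcases starS_four_free_iff.1 (mem_legalEdges.1 h).2 _ _ _ _ _ (sub ha) (sub hb) (sub hc) hy
      with h | h | h | h | h | h
    exacts [.inl h, .inr (.inl h), (ne ha h).elim, .inr (.inr h), (ne hb h).elim, (ne hc h).elim]

open Classical in
theorem value_con_le {H : SimpleGraph α} {F : SimpleGraph β} {C B : Finset (Sym2 V)} {k : ℕ} (hend : (graph C).copyCount H ≤ k)
    (h : ∀ e ∈ legalEdges F C B, value H F .Blo (insert e C) B ≤ k) :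
    value H F .Con C B ≤ k := by
  rw [value]
  split_ifs with hne
  · refine Finset.sup'_le _ _ fun e _ => ?_
    exact h e.1 e.2
  · exact hend

open Classical in
theorem value_blo_le {H : SimpleGraph α} {F : SimpleGraph β} {C B : Finset (Sym2 V)} {k : ℕ} (hend : legalEdges F C B = ∅ → (graph C).copyCount H ≤ k)
    (h : (legalEdges F C B).Nonempty →
      ∃ e ∈ freeEdges C B, value H F .Con C (insert e B) ≤ k) :
    value H F .Blo C B ≤ k := by
  rw [value]
  split_ifs with hne
  · obtain ⟨e, he, hk⟩ := h hne
    refine (Finset.inf'_le _ (Finset.mem_attach _ ⟨e, he⟩)).trans ?_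
    exact hk
  · exact hend (Finset.not_nonempty_iff_eq_empty.1 hne)

open Classical in
theorem three_mul_value_le {C B : Finset (Sym2 V)}
    (hC : (starS 4).Free (graph C))
    (I : Inv (graph C).Adj (fun x y => s(x, y) ∈ legalEdges (starS 4) C B)) :
    value (completeGraph (Fin 3)) (starS 4) .Con C B ≤ Fintype.card V / 3 := by
  induction hn : (freeEdges C B).card using Nat.strong_induction_on generalizing C B with
  | _ n ih =>
  subst hn
  have bound : ∀ {C : Finset (Sym2 V)} {L : V → V → Prop}, (starS 4).Free (graph C) →
      Inv (graph C).Adj L → (graph C).copyCount (completeGraph (Fin 3)) ≤ Fintype.card V / 3 :=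
    fun hC I => (Nat.le_div_iff_mul_le (by norm_num)).2
      ((mul_comm _ _).trans_le (three_mul_copyCount_le hC I.d))
  refine value_con_le (bound hC I) fun e he => ?_
  induction e using Sym2.inductionOn with
  | _ u v =>
  have hC' := (mem_legalEdges.1 he).2
  have hne : u ≠ v := (mem_freeEdges.1 (mem_legalEdges.1 he).1).1
  obtain ⟨p, q, hpq⟩ := I.reply (u := u) (v := v) (position hC) he
    (A' := (graph (insert s(u, v) C)).Adj) (by
      intro x y
      simp only [graph_adj, Finset.mem_insert, Sym2.eq_iff]
      constructor
      · rintro ⟨h | h, h'⟩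
        · exact .inr h
        · exact .inl ⟨h, h'⟩
      · rintro (h | ⟨rfl, rfl⟩ | ⟨rfl, rfl⟩)
        · exact ⟨.inr h.1, h.2⟩
        · exact ⟨.inl (.inl ⟨rfl, rfl⟩), hne⟩
        · exact ⟨.inl (.inr ⟨rfl, rfl⟩), hne.symm⟩)
  have key : ∀ B', B ⊆ B' → s(p, q) ∉ legalEdges (starS 4) (insert s(u, v) C) B' →
      Inv (graph (insert s(u, v) C)).Adj
        (fun x y => s(x, y) ∈ legalEdges (starS 4) (insert s(u, v) C) B') :=
    fun B' hB h => hpq _ (position hC')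
      (fun x y h => legalEdges_anti (Finset.subset_insert _ _) hB h) h
  refine value_blo_le (fun h0 => bound hC' (key B subset_rfl (by simp [h0]))) fun hlegal => ?_
  obtain ⟨f, hf, hf'⟩ : ∃ f ∈ freeEdges (insert s(u, v) C) B,
      s(p, q) ∉ legalEdges (starS 4) (insert s(u, v) C) (insert f B) := by
    -- If the desired pair is not free, it is illegal already. Blocker then claims any legal edge,
    -- which does no harm because the invariant tolerates further loss of legal edges.
    by_cases hfree : s(p, q) ∈ freeEdges (insert s(u, v) C) B
    · refine ⟨_, hfree, fun h => ?_⟩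
      simpa [mem_freeEdges] using (mem_legalEdges.1 h).1
    · obtain ⟨f, hf⟩ := hlegal
      exact ⟨f, legalEdges_subset _ _ _ hf, fun h => hfree (legalEdges_subset _ _ _
        (legalEdges_anti subset_rfl (Finset.subset_insert _ _) h))⟩
  exact ⟨f, hf, ih _ ((card_freeEdges_insert_right hf).trans
    (card_freeEdges_insert_left (mem_legalEdges.1 he).1)) hC'
    (key _ (Finset.subset_insert _ _) hf') rfl⟩

theorem g_le (n : ℕ) : g n (completeGraph (Fin 3)) (starS 4) ≤ n / 3 := by
  have hA : ∀ x y : Fin n, ¬ (graph (∅ : Finset (Sym2 (Fin n)))).Adj x y := by simp [graph_adj]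
  refine (three_mul_value_le (starS_four_free_iff.2 fun x a b c d h => (hA _ _ h).elim)
    ⟨?_, ?_, ?_, ?_, ?_, ?_, ?_, ?_⟩).trans (by simp) <;> simp [hA]

end Game
end ConstructorBlocker

/-! ### Lower bound: Constructor's claw strategy -/

namespace ConstructorBlocker
open SimpleGraph

section Claw
variable {V : Type*}

open Classical in
/-- Constructor's edges after she has added the claw with centre `f` and leaves `e`, `g`, `d`. -/
noncomputable def addClaw (C : Finset (Sym2 V)) (e f g d : V) : Finset (Sym2 V) :=
  insert s(f, d) (insert s(f, g) (insert s(f, e) C))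

open Classical in
theorem addClaw_comm (C : Finset (Sym2 V)) (e f g d : V) :
    addClaw C e f g d = addClaw C g f e d := by
  rw [addClaw, addClaw, Finset.insert_comm s(f, g)]

open Classical in
theorem subset_addClaw (C : Finset (Sym2 V)) (e f g d : V) : C ⊆ addClaw C e f g d :=
  (Finset.subset_insert _ _).trans ((Finset.subset_insert _ _).trans (Finset.subset_insert _ _))

end Claw

section Lower
variable {V : Type*} [Fintype V] {α β : Type*}

open Classical in
theorem le_value_con {H : SimpleGraph α} {F : SimpleGraph β} {C B : Finset (Sym2 V)} {k : ℕ}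
    {e : Sym2 V} (he : e ∈ legalEdges F C B) (h : k ≤ value H F .Blo (insert e C) B) :
    k ≤ value H F .Con C B := by
  rw [value, dif_pos ⟨e, he⟩]
  exact h.trans (Finset.le_sup' (fun e : legalEdges F C B => value H F .Blo (insert e.1 C) B)
    (Finset.mem_attach _ ⟨e, he⟩))

-- Allowing `B' = B` covers the finished game, where the values for both players to move agree.
open Classical in
theorem le_value_blo {H : SimpleGraph α} {F : SimpleGraph β} {C B : Finset (Sym2 V)} {k : ℕ}
    (h : ∀ B', B ⊆ B' → B'.card ≤ B.card + 1 → k ≤ value H F .Con C B') :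
    k ≤ value H F .Blo C B := by
  rw [value]
  split_ifs with hne
  · refine Finset.le_inf' _ _ fun e _ => ?_
    exact h _ (Finset.subset_insert _ _) (Finset.card_insert_le _ _)
  · have := h B subset_rfl (by simp)
    rwa [value, dif_neg hne] at this

open Classical in
theorem copyCount_mono {C C' : Finset (Sym2 V)} (h : C ⊆ C') (k : ℕ) :
    (graph C).copyCount (completeGraph (Fin k)) ≤ (graph C').copyCount (completeGraph (Fin k)) := by
  rw [copyCount_completeGraph, copyCount_completeGraph]
  exact Finset.card_le_card (cliqueFinset_mono _ (graph_mono h))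

-- Constructor can keep playing legally without ever losing a clique.
open Classical in
theorem copyCount_le_value {F : SimpleGraph β} (k : ℕ) (C B : Finset (Sym2 V)) :
    (graph C).copyCount (completeGraph (Fin k)) ≤ value (completeGraph (Fin k)) F .Con C B := by
  induction hn : (freeEdges C B).card using Nat.strong_induction_on generalizing C B with
  | _ n ih =>
  subst hn
  by_cases hne : (legalEdges F C B).Nonempty
  · obtain ⟨e, he⟩ := hne
    refine le_value_con he ?_
    have he' := card_freeEdges_insert_left (legalEdges_subset _ _ _ he)
    refine le_value_blo fun B' hB _ => (copyCount_mono (Finset.subset_insert e C) k).trans ?_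
    refine ih _ (lt_of_le_of_lt (Finset.card_le_card ?_) he') _ _ rfl
    intro x hx
    simp only [freeEdges, Finset.mem_filter] at hx ⊢
    exact ⟨hx.1, hx.2.1, hx.2.2.1, fun h => hx.2.2.2 (hB h)⟩
  · rw [value, dif_neg hne]

open Classical in
/-- The vertices joined to `x` by an edge in `C`. -/
noncomputable def nbrs (C : Finset (Sym2 V)) (x : V) : Finset V :=
  Finset.univ.filter fun y => s(x, y) ∈ C ∧ x ≠ y

theorem mem_nbrs {C : Finset (Sym2 V)} {x y : V} : y ∈ nbrs C x ↔ s(x, y) ∈ C ∧ x ≠ y := by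
  simp [nbrs]

theorem notMem_of_nbrs_eq_empty {C : Finset (Sym2 V)} {x y : V} (h : nbrs C x = ∅) (hne : x ≠ y) :
    s(x, y) ∉ C := fun h' => by
  have := mem_nbrs.2 ⟨h', hne⟩
  simp [h] at this

theorem free_of_card_nbrs {C : Finset (Sym2 V)} (h : ∀ x, (nbrs C x).card ≤ 3) :
    (starS 4).Free (graph C) := by
  classical
  refine starS_four_free_iff.2 fun x a b c d ha hb hc hd => ?_
  by_contra! hcon
  have hsub : ({a, b, c, d} : Finset V) ⊆ nbrs C x := by
    intro y hy
    simp only [Finset.mem_insert, Finset.mem_singleton] at hy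
    rw [mem_nbrs, ← graph_adj]
    rcases hy with rfl | rfl | rfl | rfl <;> assumption
  have h4 : ({a, b, c, d} : Finset V).card = 4 := by
    rw [Finset.card_insert_of_notMem, Finset.card_insert_of_notMem,
      Finset.card_insert_of_notMem, Finset.card_singleton] <;> simp [hcon]
  have := Finset.card_le_card hsub
  have := h x
  omega

open Classical in
theorem nbrs_insert_of_ne {C : Finset (Sym2 V)} {u v x : V} (hu : x ≠ u) (hv : x ≠ v) :
    nbrs (insert s(u, v) C) x = nbrs C x := by
  ext y
  simp only [mem_nbrs, Finset.mem_insert, Sym2.eq_iff]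
  tauto

open Classical in
theorem card_nbrs_insert_le (C : Finset (Sym2 V)) (u v x : V) :
    (nbrs (insert s(u, v) C) x).card ≤ (nbrs C x).card + 1 := by
  have : nbrs (insert s(u, v) C) x ⊆ insert (if x = u then v else u) (nbrs C x) := by
    intro y
    simp only [mem_nbrs, Finset.mem_insert, Sym2.eq_iff]
    split_ifs <;> grind
  exact (Finset.card_le_card this).trans (Finset.card_insert_le _ _)

open Classical in
theorem card_nbrs_insert_le_three {C : Finset (Sym2 V)} {u v : V} (h : ∀ x, (nbrs C x).card ≤ 3)
    (hu : (nbrs C u).card ≤ 2) (hv : (nbrs C v).card ≤ 2) (x : V) :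
    (nbrs (insert s(u, v) C) x).card ≤ 3 := by
  by_cases hxu : x = u
  · subst hxu
    exact (card_nbrs_insert_le _ _ _ _).trans (by omega)
  by_cases hxv : x = v
  · subst hxv
    exact (card_nbrs_insert_le _ _ _ _).trans (by omega)
  rw [nbrs_insert_of_ne hxu hxv]
  exact h x

theorem mem_legalEdges_of_card_nbrs {C B : Finset (Sym2 V)} {u v : V}
    (h : ∀ x, (nbrs C x).card ≤ 3) (hne : u ≠ v) (hC : s(u, v) ∉ C) (hB : s(u, v) ∉ B)
    (hu : (nbrs C u).card ≤ 2) (hv : (nbrs C v).card ≤ 2) :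
    s(u, v) ∈ legalEdges (starS 4) C B := by
  classical
  exact mem_legalEdges.2 ⟨mem_freeEdges.2 ⟨hne, hC, hB⟩,
    free_of_card_nbrs (card_nbrs_insert_le_three h hu hv)⟩

open Classical in
theorem card_nbrs_le_of_subset {B B' : Finset (Sym2 V)} (h : B ⊆ B') (x : V) :
    (nbrs B' x).card + B.card ≤ (nbrs B x).card + B'.card := by
  have h1 : (nbrs B' x \ nbrs B x).card ≤ (B' \ B).card := by
    refine Finset.card_le_card_of_injOn (fun y => s(x, y)) ?_ ?_
    · intro y hy
      simp only [Finset.coe_sdiff, Set.mem_sdiff, Finset.mem_coe, mem_nbrs] at hy ⊢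
      tauto
    · intro y _ z _ hyz
      simp only [Sym2.eq_iff] at hyz
      grind
  have h2 := Finset.card_sdiff_add_card (nbrs B' x) (nbrs B x)
  have h3 := Finset.card_sdiff_add_card_eq_card h
  have h4 : (nbrs B' x).card ≤ (nbrs B' x ∪ nbrs B x).card := Finset.card_le_card Finset.subset_union_left
  omega

open Classical in
theorem sum_card_nbrs_le (B : Finset (Sym2 V)) : ∑ x, (nbrs B x).card ≤ 2 * B.card := by
  rw [← Finset.card_sigma, mul_comm]
  refine (Finset.card_le_mul_card_image_of_maps_to (f := fun p => s(p.1, p.2)) (t := B) ?_ 2 ?_).trans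
    (by rw [mul_comm])
  · rintro ⟨x, y⟩ h
    simp only [Finset.mem_sigma, mem_nbrs] at h
    exact h.2.1
  · intro e _
    induction e using Sym2.inductionOn with
    | _ a b =>
    refine (Finset.card_le_card (t := {⟨a, b⟩, ⟨b, a⟩}) ?_).trans Finset.card_le_two
    rintro ⟨x, y⟩ h
    simp only [Finset.mem_filter, Sym2.eq_iff] at h
    rcases h.2 with ⟨rfl, rfl⟩ | ⟨rfl, rfl⟩ <;> simp

open Classical in
theorem exists_notMem_of_card_lt {B : Finset (Sym2 V)} {T : Finset V} {x : V}
    (h : (nbrs B x).card < T.card) : ∃ y ∈ T, y ∉ nbrs B x := by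
  by_contra! hcon
  exact absurd (Finset.card_le_card (s := T) (t := nbrs B x) hcon) (by omega)

/-- Constructor's position: the vertices in `A` are isolated, those in `D` have degree at most
one. -/
structure Stocked (C : Finset (Sym2 V)) (A D : Finset V) : Prop where
  deg : ∀ x, (nbrs C x).card ≤ 3
  fresh : ∀ x ∈ A, nbrs C x = ∅
  stock : ∀ x ∈ D, (nbrs C x).card ≤ 1
  disj : Disjoint A D

open Classical in
theorem Stocked.addClaw {C : Finset (Sym2 V)} {A D : Finset V} (h : Stocked C A D) {e f g d : V}
    (he : e ∈ A) (hf : f ∈ A) (hg : g ∈ A) (hd : d ∈ D) (hef : e ≠ f) (hfg : f ≠ g)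
    (heg : e ≠ g) :
    (∀ x, (nbrs (addClaw C e f g d) x).card ≤ 3) ∧ s(e, d) ∉ addClaw C e f g d ∧
      (nbrs (addClaw C e f g d) e).card ≤ 1 ∧ (nbrs (addClaw C e f g d) g).card ≤ 1 ∧
      (nbrs (addClaw C e f g d) d).card ≤ 2 ∧
      ∀ x, x ≠ e → x ≠ f → x ≠ g → x ≠ d → nbrs (addClaw C e f g d) x = nbrs C x := by
  have hne : ∀ {x}, x ∈ A → d ≠ x := fun hx hdx =>
    Finset.disjoint_left.1 h.disj hx (hdx ▸ hd)
  have hde := hne he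
  have hdf := hne hf
  have hdg := hne hg
  have e0 : (nbrs C e).card = 0 := by simp [h.fresh e he]
  have f0 : (nbrs C f).card = 0 := by simp [h.fresh f hf]
  have g0 : (nbrs C g).card = 0 := by simp [h.fresh g hg]
  have d0 := h.stock d hd
  have e1 := card_nbrs_insert_le C f e e
  have f1 := card_nbrs_insert_le C f e f
  have f2 := card_nbrs_insert_le (insert s(f, e) C) f g f
  have g2 := card_nbrs_insert_le (insert s(f, e) C) f g g
  rw [nbrs_insert_of_ne hfg.symm heg.symm] at g2
  have d3 := card_nbrs_insert_le (insert s(f, g) (insert s(f, e) C)) f d d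
  rw [nbrs_insert_of_ne hdf hdg, nbrs_insert_of_ne hdf hde] at d3
  refine ⟨?_, ?_, ?_, ?_, d3.trans (by omega), ?_⟩
  · refine card_nbrs_insert_le_three (card_nbrs_insert_le_three
      (card_nbrs_insert_le_three h.deg ?_ ?_) ?_ ?_) ?_ ?_
    · omega
    · omega
    · omega
    · rw [nbrs_insert_of_ne hfg.symm heg.symm]; omega
    · omega
    · rw [nbrs_insert_of_ne hdf hdg, nbrs_insert_of_ne hdf hde]; omega
  · have := notMem_of_nbrs_eq_empty (h.fresh e he) hde.symm
    simp only [ConstructorBlocker.addClaw, Finset.mem_insert, Sym2.eq_iff]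
    tauto
  · rw [ConstructorBlocker.addClaw, nbrs_insert_of_ne hef hde.symm, nbrs_insert_of_ne hef heg]
    omega
  · rw [ConstructorBlocker.addClaw, nbrs_insert_of_ne hfg.symm hdg.symm]
    omega
  · intro x hxe hxf hxg hxd
    rw [ConstructorBlocker.addClaw, nbrs_insert_of_ne hxf hxd, nbrs_insert_of_ne hxf hxg,
      nbrs_insert_of_ne hxf hxe]

-- The leaf `g` still has degree at most one and takes the place of `d`, so the stock keeps its size
-- and only three fresh vertices are spent.
open Classical in
theorem Stocked.closeTriangle {C : Finset (Sym2 V)} {A D : Finset V} (h : Stocked C A D)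
    {e f g d : V} (he : e ∈ A) (hf : f ∈ A) (hg : g ∈ A) (hd : d ∈ D) (hef : e ≠ f)
    (hfg : f ≠ g) (heg : e ≠ g) :
    Stocked (insert s(e, d) (ConstructorBlocker.addClaw C e f g d)) (A \ {e, f, g})
      (insert g (D.erase d)) := by
  obtain ⟨h3, -, h5, h6, h7, h8⟩ := h.addClaw he hf hg hd hef hfg heg
  have hgd : g ≠ d := fun hgd => Finset.disjoint_left.1 h.disj hg (hgd ▸ hd)
  refine ⟨card_nbrs_insert_le_three h3 (by omega) h7, ?_, ?_, ?_⟩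
  · intro x hx
    simp only [Finset.mem_sdiff, Finset.mem_insert, Finset.mem_singleton, not_or] at hx
    have hxd : x ≠ d := fun hxd => Finset.disjoint_left.1 h.disj hx.1 (hxd ▸ hd)
    rw [nbrs_insert_of_ne hx.2.1 hxd, h8 x hx.2.1 hx.2.2.1 hx.2.2.2 hxd, h.fresh x hx.1]
  · intro x hx
    rw [Finset.mem_insert, Finset.mem_erase] at hx
    rcases hx with rfl | ⟨hxd, hxD⟩
    · rwa [nbrs_insert_of_ne heg.symm hgd]
    · have hne : ∀ {y}, y ∈ A → x ≠ y := fun hy hxy =>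
        Finset.disjoint_left.1 h.disj hy (hxy ▸ hxD)
      rw [nbrs_insert_of_ne (hne he) hxd, h8 x (hne he) (hne hf) (hne hg) hxd]
      exact h.stock x hxD
  · rw [Finset.disjoint_left]
    intro x hx hx'
    simp only [Finset.mem_sdiff, Finset.mem_insert, Finset.mem_singleton, not_or] at hx
    rw [Finset.mem_insert, Finset.mem_erase] at hx'
    rcases hx' with rfl | ⟨-, hxD⟩
    · exact hx.2.2.2 rfl
    · exact Finset.disjoint_left.1 h.disj hx.1 hxD

open Classical in
theorem copyCount_lt_of_isolated {C C' : Finset (Sym2 V)} (hC : C ⊆ C') {e f d : V}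
    (hf : nbrs C f = ∅) (hfe : s(f, e) ∈ C') (hfd : s(f, d) ∈ C') (hed : s(e, d) ∈ C')
    (hne : f ≠ e) (hnd : f ≠ d) (hned : e ≠ d) :
    (graph C).copyCount (completeGraph (Fin 3)) <
      (graph C').copyCount (completeGraph (Fin 3)) := by
  rw [copyCount_completeGraph, copyCount_completeGraph]
  refine Finset.card_lt_card ((Finset.ssubset_iff_of_subset
    (cliqueFinset_mono _ (graph_mono hC))).2 ⟨{f, e, d}, ?_, ?_⟩)
  · rw [mem_cliqueFinset_iff, is3Clique_triple_iff]
    exact ⟨graph_adj.2 ⟨hfe, hne⟩, graph_adj.2 ⟨hfd, hnd⟩, graph_adj.2 ⟨hed, hned⟩⟩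
  · rw [mem_cliqueFinset_iff, is3Clique_triple_iff]
    exact fun h => notMem_of_nbrs_eq_empty hf hne (graph_adj.1 h.1).1

open Classical in
theorem Stocked.le_value_of_addClaw {C B : Finset (Sym2 V)} {A D : Finset V}
    (h : Stocked C A D) {e f g d : V} (he : e ∈ A) (hf : f ∈ A) (hg : g ∈ A) (hd : d ∈ D)
    (hef : e ≠ f) (hfg : f ≠ g) (heg : e ≠ g) (hB : s(e, d) ∉ B) {k : ℕ}
    (ih : ∀ (C' B' : Finset (Sym2 V)) (A' D' : Finset V), Stocked C' A' D' → B ⊆ B' → B'.card ≤ B.card + 1 →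
      A'.card + 3 = A.card → D'.card = D.card →
      (graph C).copyCount (completeGraph (Fin 3)) <
        (graph C').copyCount (completeGraph (Fin 3)) →
      k ≤ value (completeGraph (Fin 3)) (starS 4) .Con C' B') :
    k ≤ value (completeGraph (Fin 3)) (starS 4) .Con (ConstructorBlocker.addClaw C e f g d) B := by
  obtain ⟨h3, h4, h5, h6, h7, h8⟩ := h.addClaw he hf hg hd hef hfg heg
  have hne : ∀ {x}, x ∈ A → x ≠ d := fun hx hdx =>
    Finset.disjoint_left.1 h.disj hx (hdx ▸ hd)
  refine le_value_con (mem_legalEdges_of_card_nbrs h3 (hne he) h4 hB (by omega) h7)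
    (le_value_blo fun B' hB' hcard => ih _ _ _ _ (h.closeTriangle he hf hg hd hef hfg heg)
      hB' hcard ?_ ?_ ?_)
  · have hsub : ({e, f, g} : Finset V) ⊆ A := by
      simp [Finset.insert_subset_iff, he, hf, hg]
    have := Finset.card_sdiff_add_card_eq_card hsub
    rwa [Finset.card_eq_three.2 ⟨e, f, g, hef, heg, hfg, rfl⟩] at this
  · rw [Finset.card_insert_of_notMem, Finset.card_erase_add_one hd]
    exact fun hgD => Finset.disjoint_left.1 h.disj hg (Finset.mem_of_mem_erase hgD)
  · refine copyCount_lt_of_isolated ((subset_addClaw C e f g d).trans (Finset.subset_insert _ _))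
      (h.fresh f hf) (e := e) (d := d) ?_ ?_ ?_ hef.symm (hne hf) (hne he) <;>
    simp [ConstructorBlocker.addClaw]

open Classical in
/-- One round of Constructor's strategy. -/
theorem Stocked.le_value_of_round {C B : Finset (Sym2 V)} {A D : Finset V} {δ k : ℕ}
    (h : Stocked C A D) (hD : 3 * δ + 7 ≤ D.card)
    (hA : δ + 4 ≤ (A.filter fun x => (nbrs B x).card ≤ δ).card)
    (ih : ∀ (C' B' : Finset (Sym2 V)) (A' D' : Finset V), Stocked C' A' D' → B'.card ≤ B.card + 4 →
      A'.card + 3 = A.card → D'.card = D.card →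
      (graph C).copyCount (completeGraph (Fin 3)) <
        (graph C').copyCount (completeGraph (Fin 3)) →
      k ≤ value (completeGraph (Fin 3)) (starS 4) .Con C' B') :
    k ≤ value (completeGraph (Fin 3)) (starS 4) .Con C B := by
  set T := A.filter fun x => (nbrs B x).card ≤ δ with hT
  have memT : ∀ {x}, x ∈ T → x ∈ A ∧ (nbrs B x).card ≤ δ := fun hx => Finset.mem_filter.1 hx
  obtain ⟨e, heT⟩ : T.Nonempty := Finset.card_pos.1 (by omega)
  obtain ⟨he, heδ⟩ := memT heT
  obtain ⟨f, hfT, hf'⟩ : ∃ f ∈ T.erase e, f ∉ nbrs B e :=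
    exists_notMem_of_card_lt (B := B) (x := e) (by rw [Finset.card_erase_of_mem heT]; omega)
  obtain ⟨hfe, hfT⟩ := Finset.mem_erase.1 hfT
  obtain ⟨hf, hfδ⟩ := memT hfT
  have hfeB : s(f, e) ∉ B := fun hB => hf' (mem_nbrs.2 ⟨by rwa [Sym2.eq_swap], hfe.symm⟩)
  have e0 : (nbrs C e).card = 0 := by simp [h.fresh e he]
  have f0 : (nbrs C f).card = 0 := by simp [h.fresh f hf]
  refine le_value_con (mem_legalEdges_of_card_nbrs h.deg hfe
    (notMem_of_nbrs_eq_empty (h.fresh f hf) hfe) hfeB (by omega) (by omega))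
    (le_value_blo fun B₁ hB₁ hc₁ => ?_)
  have hfδ₁ := card_nbrs_le_of_subset hB₁ f
  -- At least `δ + 2` candidates remain, against at most `δ + 1` Blocker neighbours of `f`; this
  -- fixes the constant in `δ + 4`.
  obtain ⟨g, hgT, hg'⟩ : ∃ g ∈ (T.erase e).erase f, g ∉ nbrs B₁ f :=
    exists_notMem_of_card_lt (B := B₁) (x := f) (by
      rw [Finset.card_erase_of_mem (Finset.mem_erase.2 ⟨hfe, hfT⟩), Finset.card_erase_of_mem heT]
      omega)
  obtain ⟨hgf, hgT⟩ := Finset.mem_erase.1 hgT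
  obtain ⟨hge, hgT⟩ := Finset.mem_erase.1 hgT
  obtain ⟨hg, hgδ⟩ := memT hgT
  have g0 : (nbrs C g).card = 0 := by simp [h.fresh g hg]
  have f1 := card_nbrs_insert_le C f e f
  have deg₁ := card_nbrs_insert_le_three (u := f) (v := e) h.deg (by omega) (by omega)
  have hfgC : s(f, g) ∉ insert s(f, e) C := by
    have := notMem_of_nbrs_eq_empty (h.fresh f hf) hgf.symm
    simp only [Finset.mem_insert, Sym2.eq_iff]
    tauto
  have g1 : (nbrs (insert s(f, e) C) g).card = 0 := by rw [nbrs_insert_of_ne hgf hge, g0]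
  refine le_value_con (mem_legalEdges_of_card_nbrs deg₁ hgf.symm hfgC
    (fun hB => hg' (mem_nbrs.2 ⟨hB, hgf.symm⟩)) (by omega) (by omega))
    (le_value_blo fun B₂ hB₂ hc₂ => ?_)
  have hB₀₂ := hB₁.trans hB₂
  have heδ₂ := card_nbrs_le_of_subset hB₀₂ e
  have hfδ₂ := card_nbrs_le_of_subset hB₀₂ f
  have hgδ₂ := card_nbrs_le_of_subset hB₀₂ g
  -- After two replies each of `e`, `f`, `g` has Blocker degree at most `δ + 2`, so they exclude at
  -- most `3 * δ + 6` vertices of the stock.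
  obtain ⟨d, hd, hd'⟩ : ∃ d ∈ D, d ∉ nbrs B₂ e ∪ (nbrs B₂ f ∪ nbrs B₂ g) := by
    by_contra! hcon
    have h1 := Finset.card_le_card (s := D) hcon
    have h2 := Finset.card_union_le (nbrs B₂ e) (nbrs B₂ f ∪ nbrs B₂ g)
    have h3 := Finset.card_union_le (nbrs B₂ f) (nbrs B₂ g)
    omega
  have hne : ∀ {x}, x ∈ A → x ≠ d := fun hx hdx =>
    Finset.disjoint_left.1 h.disj hx (hdx ▸ hd)
  simp only [Finset.mem_union, mem_nbrs, not_or, not_and_or, not_not] at hd'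
  have hedB : s(e, d) ∉ B₂ := hd'.1.resolve_right (hne he)
  have hfdB : s(f, d) ∉ B₂ := hd'.2.1.resolve_right (hne hf)
  have hgdB : s(g, d) ∉ B₂ := hd'.2.2.resolve_right (hne hg)
  have f2 := card_nbrs_insert_le (insert s(f, e) C) f g f
  have deg₂ := card_nbrs_insert_le_three (u := f) (v := g) deg₁ (by omega) (by omega)
  have hfdC : s(f, d) ∉ insert s(f, g) (insert s(f, e) C) := by
    have := notMem_of_nbrs_eq_empty (h.fresh f hf) (hne hf)
    have := hne he
    have := hne hg
    have := hne hf
    simp only [Finset.mem_insert, Sym2.eq_iff]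
    tauto
  have d2 : (nbrs (insert s(f, g) (insert s(f, e) C)) d).card ≤ 1 := by
    rw [nbrs_insert_of_ne (hne hf).symm (hne hg).symm,
      nbrs_insert_of_ne (hne hf).symm (hne he).symm]
    exact h.stock d hd
  refine le_value_con (mem_legalEdges_of_card_nbrs deg₂ (hne hf) hfdC hfdB (by omega) (by omega))
    (le_value_blo fun B₃ hB₃ hc₃ => ?_)
  change k ≤ value _ _ _ (ConstructorBlocker.addClaw C e f g d) B₃
  -- The double threat: both edges were free before Blocker's last single move.
  have hfree : s(e, d) ∉ B₃ ∨ s(g, d) ∉ B₃ := by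
    by_contra! hcon
    have hs : ({s(e, d), s(g, d)} : Finset (Sym2 V)) ⊆ B₃ \ B₂ := by
      simp [Finset.insert_subset_iff, hcon, hedB, hgdB]
    have h1 := Finset.card_le_card hs
    rw [Finset.card_pair (by simp [hge.symm, hne he])] at h1
    have := Finset.card_sdiff_add_card_eq_card hB₃
    omega
  rcases hfree with hfree | hfree
  · exact h.le_value_of_addClaw he hf hg hd hfe.symm hgf.symm hge.symm hfree
      fun C' B' A' D' hs hB hc => ih C' B' A' D' hs (by omega)
  · rw [addClaw_comm]
    exact h.le_value_of_addClaw hg hf he hd hgf hfe hge hfree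
      fun C' B' A' D' hs hB hc => ih C' B' A' D' hs (by omega)

-- Blocker degrees sum to at most `2 * B.card`, so at most `m` vertices exceed `δ`.
open Classical in
theorem card_low {B : Finset (Sym2 V)} {A : Finset V} {δ m : ℕ} (hB : 2 * B.card ≤ m * (δ + 1))
    (hA : δ + 4 + m ≤ A.card) : δ + 4 ≤ (A.filter fun x => (nbrs B x).card ≤ δ).card := by
  have h1 := Finset.card_filter_add_card_filter_not (s := A) (fun x => (nbrs B x).card ≤ δ)
  have h2 : (A.filter fun x => ¬ (nbrs B x).card ≤ δ).card * (δ + 1) ≤ 2 * B.card := by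
    refine le_trans ?_ (sum_card_nbrs_le B)
    rw [← smul_eq_mul]
    refine (Finset.card_nsmul_le_sum _ (fun x => (nbrs B x).card) _ ?_).trans
      (Finset.sum_le_sum_of_subset (Finset.subset_univ _))
    intro x hx
    have := (Finset.mem_filter.1 hx).2
    omega
  have h3 : (A.filter fun x => ¬ (nbrs B x).card ≤ δ).card ≤ m :=
    Nat.le_of_mul_le_mul_right (h2.trans hB) (Nat.succ_pos δ)
  omega

theorem Stocked.add_le_value {δ m K : ℕ} (hK : 2 * K ≤ m * (δ + 1)) (k : ℕ)
    {C B : Finset (Sym2 V)} {A D : Finset V} (h : Stocked C A D) (hD : 3 * δ + 7 ≤ D.card)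
    (hA : δ + 4 + m + 3 * k ≤ A.card) (hB : B.card + 4 * k ≤ K) :
    (graph C).copyCount (completeGraph (Fin 3)) + k ≤
      value (completeGraph (Fin 3)) (starS 4) .Con C B := by
  induction k generalizing C B A D with
  | zero => exact copyCount_le_value 3 C B
  | succ k ih =>
    refine h.le_value_of_round hD (card_low (m := m)
      ((Nat.mul_le_mul_left 2 (by omega)).trans hK) (by omega))
      fun C' B' A' D' hs hB' hA' hD' hlt => ?_
    have := ih (B := B') hs (by omega) (by omega) (by omega)
    omega

theorem le_g (n : ℕ) : n ≤ 3 * g n (completeGraph (Fin 3)) (starS 4) + 12 * n.sqrt + 21 := by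
  classical
  set δ := n.sqrt with hδ
  have hn : n < (δ + 1) * (δ + 1) := Nat.lt_succ_sqrt n
  obtain hsmall | hlarge := le_or_gt n (12 * δ + 19)
  · omega
  obtain ⟨D, -, hD⟩ := Finset.exists_subset_card_eq
    (s := (Finset.univ : Finset (Fin n))) (n := 3 * δ + 7) (by simp; omega)
  have hempty : ∀ x : Fin n, nbrs ∅ x = ∅ := by simp [nbrs]
  have hst : Stocked (∅ : Finset (Sym2 (Fin n))) Dᶜ D :=
    ⟨by simp [hempty], fun x _ => hempty x, by simp [hempty], disjoint_compl_left⟩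
  have hDc : Dᶜ.card = n - (3 * δ + 7) := by rw [Finset.card_compl, hD, Fintype.card_fin]
  -- With four replies per round and at most `n` rounds, `K = 4 * n` bounds Blocker's edges, and `n
  -- < (δ + 1) ^ 2` permits this `m`. The reserve is `(3 * δ + 7) + (δ + 4) + 8 * (δ + 1) = 12 * δ +
  -- 19`; rounding costs two more.
  have := hst.add_le_value (δ := δ) (m := 8 * (δ + 1)) (K := 4 * n) (B := ∅) (by nlinarith)
    ((n - (12 * δ + 19)) / 3) hD.ge (by omega) (by simp; omega)
  have hg : (n - (12 * δ + 19)) / 3 ≤ g n (completeGraph (Fin 3)) (starS 4) := by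
    rw [g]
    omega
  omega

end Lower

end ConstructorBlocker

/-! ### Asymptotics -/

/-- `g(n, K₃, S₄) = (1 + o(1)) n / 3`. -/
theorem theorem3 :
    ∃ ε : ℕ → ℝ, Filter.Tendsto ε Filter.atTop (nhds 0) ∧
      ∀ n : ℕ, (ConstructorBlocker.g n (SimpleGraph.completeGraph (Fin 3)) (ConstructorBlocker.starS 4) : ℝ) =
        (1 + ε n) * ((n : ℝ) / 3) := by
  set G : ℕ → ℕ := fun n =>
    ConstructorBlocker.g n (SimpleGraph.completeGraph (Fin 3)) (ConstructorBlocker.starS 4) with hG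
  have upper : ∀ n, (G n : ℝ) * 3 ≤ n := fun n => by
    have : G n * 3 ≤ n := (Nat.le_div_iff_mul_le (by norm_num)).1 (ConstructorBlocker.g_le n)
    exact_mod_cast this
  have lower : ∀ n : ℕ, (n : ℝ) ≤ 3 * G n + 12 * √n + 21 := fun n => by
    have h1 : (n : ℝ) ≤ 3 * G n + 12 * n.sqrt + 21 := by exact_mod_cast ConstructorBlocker.le_g n
    have h2 := Real.nat_sqrt_le_real_sqrt (a := n)
    linarith
  refine ⟨fun n => G n * 3 / n - 1, ?_, fun n => ?_⟩
  · have lim : Filter.Tendsto (fun n : ℕ => -(12 * (1 / √(n : ℝ)) + 21 * (1 / (n : ℝ))))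
        Filter.atTop (nhds 0) := by
      have hs : Filter.Tendsto (fun n : ℕ => 1 / √(n : ℝ)) Filter.atTop (nhds 0) :=
        (tendsto_const_nhds.div_atTop
          (Real.tendsto_sqrt_atTop.comp tendsto_natCast_atTop_atTop))
      simpa using ((hs.const_mul 12).add
        ((tendsto_one_div_atTop_nhds_zero_nat (𝕜 := ℝ)).const_mul 21)).neg
    refine tendsto_of_tendsto_of_tendsto_of_le_of_le' lim tendsto_const_nhds ?_ ?_
    · filter_upwards [Filter.eventually_gt_atTop 0] with n hn
      have hn' : (0 : ℝ) < n := by exact_mod_cast hn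
      have hs : √(n : ℝ) / n = 1 / √n := Real.sqrt_div_self'
      have h : (n - 12 * √(n : ℝ) - 21) / n ≤ G n * 3 / n := by
        gcongr
        linarith [lower n]
      rw [sub_div, sub_div, div_self hn'.ne', mul_div_assoc, hs] at h
      rw [mul_one_div 21]
      linarith
    · filter_upwards [Filter.eventually_gt_atTop 0] with n hn
      have hn' : (0 : ℝ) < n := by exact_mod_cast hn
      rw [sub_nonpos, div_le_one hn']
      exact upper n
  -- At `n = 0` the quotient in `ε` is a junk value, but both sides vanish.
  · rcases Nat.eq_zero_or_pos n with rfl | hn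
    · have := upper 0
      simp only [Nat.cast_zero] at this ⊢
      have h0 : (0 : ℝ) ≤ G 0 := Nat.cast_nonneg _
      simp only [zero_div, mul_zero]
      change (G 0 : ℝ) = 0
      linarith
    · have hn' : (n : ℝ) ≠ 0 := by exact_mod_cast hn.ne'
      change (G n : ℝ) = _
      field_simp
      ring
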